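/- Let $A, B, C$ be integers with $$A^2 = 2(B^2+C^2), \qquad (A,B)=(B,C)=(C,A)=1, \qquad A>0,$$ and let $p$ be an odd prime with $\left(\frac{2}{p}\right)=+1$. The symbol $\left(\frac{A+B\sqrt2}{p}\right)$ denotes the Legendre symbol $\left(\frac{A+Br}{p}\right)$, where $r$ is an integer with $r^2\equiv 2 \pmod p$ and $p\nmid A+Br$. Such an $r$ exists (the condition $p\nmid A+Br$ holds automatically if $p\nmid C$), and for every such $r$, $$\left(\frac{A+B\sqrt2}{p}\right)=1 \iff p \text{ splits completely in } \mathbb{Q}\left(\sqrt{2+\sqrt2}\,\right) \iff p\equiv \pm1 \pmod{16}.$$ -/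

import Mathlib

/-- The field `ℚ(√(2 + √2))`, as a subfield of the real numbers. -/
noncomputable def quarticField : IntermediateField ℚ ℝ :=
  IntermediateField.adjoin ℚ {Real.sqrt (2 + Real.sqrt 2)}

noncomputable instance quarticField_numberField : NumberField quarticField where
  to_charZero := inferInstance
  to_finiteDimensional := by
    have h2 : Real.sqrt 2 ^ 2 = 2 := Real.sq_sqrt (by norm_num)
    have h : Real.sqrt (2 + Real.sqrt 2) ^ 2 = 2 + Real.sqrt 2 :=
      Real.sq_sqrt (by positivity)
    have hint : IsIntegral ℚ (Real.sqrt (2 + Real.sqrt 2)) := by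
      have hs : IsIntegral ℚ (Real.sqrt 2) :=
        by
        refine IsIntegral.of_pow (n := 2) (by norm_num) ?_
        rw [h2]
        exact isIntegral_algebraMap (x := (2 : ℚ))
      refine IsIntegral.of_pow (n := 2) (by norm_num) ?_
      rw [h]
      exact (isIntegral_algebraMap (x := (2 : ℚ))).add hs
    exact IntermediateField.adjoin.finiteDimensional hint

/-- The rational prime `p` splits (completely) in the number field `K`: the number of prime
ideals of the ring of integers of `K` above `p` is the degree `[K : ℚ]`. -/
def SplitsIn (p : ℕ) (K : Type*) [Field K] [NumberField K] : Prop :=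
  ((Ideal.span {(p : ℤ)}).primesOver (NumberField.RingOfIntegers K)).ncard =
    Module.finrank ℚ K

/-! Everything reduces to whether `2 + r` is a square modulo `p`. Halving `B + C` and `B - C` turns
the equation into a Pythagorean triple, and its parameters satisfy `(A + B√2)(2 + √2) = ((2 + √2)m +
√2 n)²`, so `A + Br` and `2 + r` have the same quadratic character. Since `√(2 + √2)` is a root of
`(X² - 2)² - 2`, splitting means that this quartic has a root modulo `p`
(`splitsIn_iff_exists_root`), i.e. that `2 + r` is a square. Finally `2 + r = (ζ + ζ⁻¹)²` with `ζ ^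
8 = -1`, and Frobenius fixes `ζ + ζ⁻¹` exactly when `p ≡ ±1` modulo `16`. -/

/-! ### Pythagorean parametrization. -/

/-- Parametrization of the integral solutions of `A ^ 2 = 2 * (B ^ 2 + C ^ 2)` with `B`, `C`
coprime and `A` positive. -/
theorem exists_param_of_sq_eq_two_mul {A B C : ℤ} (h : A ^ 2 = 2 * (B ^ 2 + C ^ 2))
    (hBC : IsCoprime B C) (hA : 0 < A) :
    ∃ m n : ℤ, A = 2 * (m ^ 2 + n ^ 2) ∧ B = m ^ 2 - n ^ 2 + 2 * m * n := by
  have hA2 : Even A := by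
    have : Even (A ^ 2) := ⟨B ^ 2 + C ^ 2, by rw [h]; ring⟩
    exact (Int.even_pow.1 this).1
  obtain ⟨a, rfl⟩ := hA2
  have h' : B ^ 2 + C ^ 2 = 2 * a ^ 2 := by linarith
  have hsum : Even (B + C) := by
    have : Even (B ^ 2 + C ^ 2) := ⟨a ^ 2, by rw [h']; ring⟩
    simpa [Int.even_add, Int.even_pow] using this
  obtain ⟨x, hx⟩ := hsum
  obtain ⟨y, hy⟩ : ∃ y, y = B - x := ⟨_, rfl⟩
  obtain rfl : B = x + y := by linarith
  obtain rfl : C = x - y := by linarith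
  have hcop : IsCoprime x y := by
    obtain ⟨u, v, huv⟩ := hBC
    exact ⟨u + v, u - v, by linear_combination huv⟩
  have ht : PythagoreanTriple x y a := by
    unfold PythagoreanTriple
    linarith
  obtain ⟨m, n, hxy, ha, -, -⟩ :=
    PythagoreanTriple.coprime_classification.1 ⟨ht, Int.isCoprime_iff_gcd_eq_one.1 hcop⟩
  refine ⟨m, n, ?_, ?_⟩
  · rcases ha with ha | ha
    · rw [ha]; ring
    · nlinarith [sq_nonneg m, sq_nonneg n]
  -- Swapping the legs does not change `B = x + y`.
  · rcases hxy with ⟨h1, h2⟩ | ⟨h1, h2⟩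
    · rw [h1, h2]
    · rw [h1, h2]; ring

theorem isSquare_iff_isSquare_of_mul_eq_sq {F : Type*} [Field F] {u v w : F} (hu : u ≠ 0)
    (hv : v ≠ 0) (h : u * v = w ^ 2) : IsSquare u ↔ IsSquare v := by
  constructor
  · rintro ⟨s, rfl⟩
    have hs : s ≠ 0 := left_ne_zero_of_mul hu
    refine ⟨w / s, ?_⟩
    field_simp
    linear_combination h
  · rintro ⟨s, rfl⟩
    have hs : s ≠ 0 := left_ne_zero_of_mul hv
    refine ⟨w / s, ?_⟩
    field_simp
    linear_combination h

theorem two_add_ne_zero_of_sq_eq_two {F : Type*} [Field F] (h2 : (2 : F) ≠ 0) {r : F}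
    (hr : r ^ 2 = 2) : 2 + r ≠ 0 := by
  intro h
  apply h2
  linear_combination (2 - r) * h + hr

/-! ### Frobenius and sixteenth roots of unity. -/

/-- If `ζ ^ 8 = -1` and `p ≡ ±1` modulo `8`, then `ζ + ζ⁻¹` is fixed by the `p`-power Frobenius
if and only if `p ≡ ±1` modulo `16`. -/
theorem add_inv_pow_char_eq_self_iff {F : Type*} [Field F] {p : ℕ} [Fact p.Prime] [CharP F p]
    (h2 : (2 : F) ≠ 0) (hp : p % 8 = 1 ∨ p % 8 = 7) {ζ : F} (hζ : ζ ^ 8 = -1) :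
    (ζ + ζ⁻¹) ^ p = ζ + ζ⁻¹ ↔ p % 16 = 1 ∨ p % 16 = 15 := by
  have h0 : ζ ≠ 0 := by
    rintro rfl
    norm_num at hζ
  have h16 : ζ ^ 16 = 1 := by
    linear_combination (ζ ^ 8 - 1) * hζ
  have ht : ζ + ζ⁻¹ ≠ 0 := by
    intro h
    have h1 : ζ ^ 2 = -1 := by
      field_simp at h
      linear_combination h
    apply h2
    linear_combination hζ - (ζ ^ 6 - ζ ^ 4 + ζ ^ 2 - 1) * h1
  have key : (ζ + ζ⁻¹) ^ p = ζ ^ (p % 16) + (ζ ^ (p % 16))⁻¹ := by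
    rw [add_pow_char, inv_pow]
    conv_lhs => rw [← Nat.mod_add_div p 16]
    rw [pow_add, pow_mul, h16, one_pow, mul_one]
  -- For `p ≡ 7, 9` modulo `16`, `ζ ^ 8 = -1` makes Frobenius negate `ζ + ζ⁻¹`.
  have hneg (h : (ζ + ζ⁻¹) ^ p = -(ζ + ζ⁻¹)) : (ζ + ζ⁻¹) ^ p ≠ ζ + ζ⁻¹ := by
    rw [h]
    intro h'
    apply mul_ne_zero h2 ht
    linear_combination -h'
  have hcases : p % 16 = 1 ∨ p % 16 = 7 ∨ p % 16 = 9 ∨ p % 16 = 15 := by omega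
  rcases hcases with h | h | h | h
  · rw [h] at key
    simp [key, h]
  · have h7 : ζ ^ 7 = -ζ⁻¹ := by
      field_simp
      linear_combination hζ
    rw [h, h7] at key
    simp only [h]
    refine iff_of_false (hneg ?_) (by norm_num)
    rw [key, inv_neg, inv_inv]
    ring
  · have h9 : ζ ^ 9 = -ζ := by linear_combination ζ * hζ
    rw [h, h9] at key
    simp only [h]
    refine iff_of_false (hneg ?_) (by norm_num)
    rw [key, inv_neg]
    ring
  · have h15 : ζ ^ 15 = ζ⁻¹ := by
      field_simp
      linear_combination h16
    rw [h, h15] at key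
    simp only [h, key, inv_inv]
    simp [add_comm]

theorem IsAlgClosed.exists_add_inv_sq_eq {F : Type*} [Field F] [IsAlgClosed F] {ρ : F}
    (hρ : ρ ^ 2 = 2) : ∃ ζ : F, ζ ^ 8 = -1 ∧ (ζ + ζ⁻¹) ^ 2 = 2 + ρ := by
  obtain ⟨ζ, hζ⟩ := IsAlgClosed.exists_pow_nat_eq (-1 : F) (show 0 < 8 by norm_num)
  have h0 : ζ ≠ 0 := by
    rintro rfl
    norm_num at hζ
  have hprod : (ζ ^ 2 + (ζ⁻¹) ^ 2 - ρ) * (ζ ^ 2 + (ζ⁻¹) ^ 2 + ρ) = 0 := by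
    have : (ζ ^ 2 + (ζ⁻¹) ^ 2) ^ 2 = 2 := by
      field_simp
      linear_combination hζ
    linear_combination this - hρ
  rcases mul_eq_zero.1 hprod with h | h
  · refine ⟨ζ, hζ, ?_⟩
    have := mul_inv_cancel₀ h0
    linear_combination h + 2 * this
  -- Since `ζ⁶ = -ζ⁻²`, replacing `ζ` by `ζ³` changes the sign of `ζ² + ζ⁻²`.
  · refine ⟨ζ ^ 3, by rw [← pow_mul, mul_comm, pow_mul, hζ]; norm_num, ?_⟩
    have h1 : (ζ ^ 3 + (ζ ^ 3)⁻¹) ^ 2 = 2 - (ζ ^ 2 + (ζ⁻¹) ^ 2) := by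
      field_simp
      linear_combination (ζ ^ 4 + 1) * hζ
    linear_combination h1 - h

/-- The supplementary law for `2 + √2`. -/
theorem ZMod.isSquare_two_add_sqrt_two_iff {p : ℕ} [Fact p.Prime] (hp2 : p ≠ 2)
    (hp : p % 8 = 1 ∨ p % 8 = 7) {r : ZMod p} (hr : r ^ 2 = 2) :
    IsSquare (2 + r) ↔ p % 16 = 1 ∨ p % 16 = 15 := by
  let F := AlgebraicClosure (ZMod p)
  have : CharP F p := charP_of_injective_algebraMap (algebraMap (ZMod p) F).injective p
  have h2 : (2 : F) ≠ 0 := Ring.two_ne_zero (by rwa [ringChar.eq F p])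
  let φ := algebraMap (ZMod p) F
  obtain ⟨ζ, hζ, hζr⟩ := IsAlgClosed.exists_add_inv_sq_eq (ρ := φ r)
    (by rw [← map_pow, hr, map_ofNat])
  rw [← add_inv_pow_char_eq_self_iff h2 hp hζ, ← Subfield.mem_bot_iff_pow_eq_self F p]
  constructor
  · rintro ⟨s, hs⟩
    have h : (ζ + ζ⁻¹) ^ 2 = (φ s) ^ 2 := by
      rw [hζr, ← map_pow, pow_two, ← hs, map_add, map_ofNat]
    have hmem : φ s ∈ (⊥ : Subfield F) := by
      rw [Subfield.mem_bot_iff_pow_eq_self F p, ← map_pow, ZMod.pow_card]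
    rcases sq_eq_sq_iff_eq_or_eq_neg.1 h with h | h
    · rwa [h]
    · rw [h]; exact neg_mem hmem
  · intro h
    have : (⊥ : Subfield F) ≤ φ.fieldRange := bot_le
    obtain ⟨s, hs⟩ := this h
    refine ⟨s, φ.injective ?_⟩
    rw [map_add, map_ofNat, ← hζr, ← hs, map_mul, pow_two]

/-! ### Splitting of primes in number fields. -/

section NumberField

open NumberField Polynomial

theorem Int.isPrime_span_natCast (p : ℕ) [Fact p.Prime] : (Ideal.span {(p : ℤ)}).IsPrime := by
  rw [Ideal.span_singleton_prime (by exact_mod_cast (Fact.out : p.Prime).ne_zero)]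
  exact Nat.prime_iff_prime_int.1 Fact.out

theorem Int.span_natCast_ne_bot (p : ℕ) [Fact p.Prime] : Ideal.span {(p : ℤ)} ≠ ⊥ := by
  simpa using (Fact.out : p.Prime).ne_zero

theorem Ideal.intCast_mem_iff_of_liesOver {p : ℕ} {R : Type*} [CommRing R] (P : Ideal R)
    [hP : P.LiesOver (Ideal.span {(p : ℤ)})] (n : ℤ) : (n : R) ∈ P ↔ (n : ZMod p) = 0 := by
  rw [ZMod.intCast_zmod_eq_zero_iff_dvd, ← Ideal.mem_span_singleton, hP.over]
  simp

variable (p : ℕ) [Fact p.Prime] (K : Type*) [Field K] [NumberField K]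

theorem finite_primesOver_span_natCast :
    ((Ideal.span {(p : ℤ)}).primesOver (𝓞 K)).Finite := by
  have := (Int.isPrime_span_natCast p).isMaximal (Int.span_natCast_ne_bot p)
  exact IsDedekindDomain.primesOver_finite _ _

/-- In `∑ e f = [K : ℚ]` each term is at least `1`. -/
theorem ncard_primesOver_le_finrank :
    ((Ideal.span {(p : ℤ)}).primesOver (𝓞 K)).ncard ≤ Module.finrank ℚ K := by
  have := Int.isPrime_span_natCast p
  have := (finite_primesOver_span_natCast p K).fintype
  rw [← RingOfIntegers.rank K, ← Ideal.sum_ramification_inertia_eq_finrank (Ideal.span {(p : ℤ)}),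
    ← Nat.card_coe_set_eq, Nat.card_eq_fintype_card, Fintype.card_eq_sum_ones]
  refine Finset.sum_le_sum fun P _ => ?_
  have := P.2.1
  exact Nat.mul_pos (P.1.ramificationIdx_pos ℤ) (P.1.inertiaDeg_pos ℤ)

variable {K}

/-- If `p` splits completely in `K`, some residue field above `p` is the prime field. -/
theorem SplitsIn.exists_forall_sub_mem {p : ℕ} [Fact p.Prime] (h : SplitsIn p K) :
    ∃ P ∈ (Ideal.span {(p : ℤ)}).primesOver (𝓞 K), ∀ x : 𝓞 K, ∃ n : ℤ, x - n ∈ P := by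
  have := Int.isPrime_span_natCast p
  have hmax := (Int.isPrime_span_natCast p).isMaximal (Int.span_natCast_ne_bot p)
  have := (finite_primesOver_span_natCast p K).fintype
  obtain ⟨P, hP⟩ : ∃ P : (Ideal.span {(p : ℤ)}).primesOver (𝓞 K), P.1.inertiaDeg ℤ ≤ 1 := by
    by_contra! hlt
    have hsum := Ideal.sum_ramification_inertia_eq_finrank (Ideal.span {(p : ℤ)}) (𝓞 K)
    rw [RingOfIntegers.rank K, ← h, ← Nat.card_coe_set_eq, Nat.card_eq_fintype_card,
      Fintype.card_eq_sum_ones] at hsum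
    have hne : (Finset.univ : Finset ((Ideal.span {(p : ℤ)}).primesOver (𝓞 K))).Nonempty := by
      rw [Finset.univ_nonempty_iff]
      exact Ideal.nonempty_primesOver _
    refine (Finset.sum_lt_sum_of_nonempty hne fun P _ => ?_).ne' hsum
    have := P.2.1
    exact (hlt P).trans_le (Nat.le_mul_of_pos_left _ (P.1.ramificationIdx_pos ℤ))
  refine ⟨P, P.2, fun x => ?_⟩
  have := P.2.1
  have := P.2.2
  have := Ideal.IsMaximal.of_liesOver_isMaximal P.1 (Ideal.span {(p : ℤ)})
  have h1 : Module.finrank (ℤ ⧸ Ideal.span {(p : ℤ)}) (𝓞 K ⧸ P.1) = 1 := by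
    rw [← Ideal.inertiaDeg_eq_of_isMaximal]
    exact le_antisymm hP (P.1.inertiaDeg_pos ℤ)
  let := Ideal.Quotient.field (Ideal.span {(p : ℤ)})
  obtain ⟨c, hc⟩ := (finrank_eq_one_iff_of_nonzero' (1 : 𝓞 K ⧸ P.1) one_ne_zero).1 h1
    (Ideal.Quotient.mk P.1 x)
  obtain ⟨n, rfl⟩ := Ideal.Quotient.mk_surjective c
  refine ⟨n, ?_⟩
  rw [← Ideal.Quotient.eq, ← hc, Algebra.smul_def, mul_one,
    Ideal.Quotient.algebraMap_mk_of_liesOver]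
  simp

/-- Every root modulo `p` of a monic irreducible polynomial over `ℤ` with root `θ` is the
reduction of `θ` modulo some prime above `p`. -/
theorem exists_mem_primesOver_sub_mem {p : ℕ} [Fact p.Prime] {f : ℤ[X]} (hf : Irreducible f)
    {θ : 𝓞 K} (hθ : aeval θ f = 0) {a : ℤ} (ha : ((f.eval a : ℤ) : ZMod p) = 0) :
    ∃ P ∈ (Ideal.span {(p : ℤ)}).primesOver (𝓞 K), θ - a ∈ P := by
  have hint : IsIntegral ℤ θ := Algebra.IsIntegral.isIntegral θ
  let ψ : ℤ[X] →+* ZMod p := eval₂RingHom (Int.castRingHom (ZMod p)) a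
  have hψ (g : ℤ[X]) : ψ g = ((g.eval a : ℤ) : ZMod p) := by
    simp [ψ, eval₂_eq_eval_map]
  -- Let `X` act as `θ`: lying over applies to the kernel of evaluation at `a` modulo `p`, which
  -- contains every polynomial vanishing at `θ`.
  let := (aeval θ : ℤ[X] →ₐ[ℤ] 𝓞 K).toRingHom.toAlgebra
  have : IsScalarTower ℤ ℤ[X] (𝓞 K) := IsScalarTower.of_algebraMap_eq fun n => by
    simp [RingHom.algebraMap_toAlgebra]
  have : Algebra.IsIntegral ℤ[X] (𝓞 K) := Algebra.IsIntegral.tower_top ℤ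
  have hdvd : f ∣ minpoly ℤ θ :=
    ((minpoly.prime_of_isIntegrallyClosed hint).irreducible.dvd_symm hf
      (minpoly.isIntegrallyClosed_dvd hint hθ))
  have : (RingHom.ker ψ).IsPrime := RingHom.ker_isPrime ψ
  obtain ⟨P, -, hP, hcomap⟩ := Ideal.exists_ideal_over_prime_of_isIntegral (RingHom.ker ψ)
    (⊥ : Ideal (𝓞 K)) (by
      intro g hg
      obtain ⟨q, rfl⟩ := hdvd.trans (minpoly.isIntegrallyClosed_dvd hint (p := g) hg)
      rw [RingHom.mem_ker, map_mul, hψ f, ha, zero_mul])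
  have hmem (g : ℤ[X]) : aeval θ g ∈ P ↔ ((g.eval a : ℤ) : ZMod p) = 0 := by
    rw [← hψ, ← RingHom.mem_ker, ← hcomap]
    rfl
  refine ⟨P, ⟨hP, ⟨?_⟩⟩, ?_⟩
  · ext n
    rw [Ideal.mem_span_singleton, ← ZMod.intCast_zmod_eq_zero_iff_dvd]
    simpa using (hmem (C n)).symm
  · have h := (hmem (X - C a)).2 (by simp)
    rwa [map_sub, aeval_X, aeval_C] at h

/-! ### The quartic field. -/

theorem irreducible_X_pow_four_sub : Irreducible (X ^ 4 - 4 * X ^ 2 + 2 : ℤ[X]) := by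
  have hdeg : (X ^ 4 - 4 * X ^ 2 + 2 : ℤ[X]).degree = 4 := by compute_degree!
  have hmonic : (X ^ 4 - 4 * X ^ 2 + 2 : ℤ[X]).Monic := by monicity!
  refine irreducible_of_eisenstein_criterion (P := Ideal.span {2}) ?_ ?_ ?_ ?_ ?_
    hmonic.isPrimitive
  · exact (Ideal.span_singleton_prime two_ne_zero).2 Int.prime_two
  · rw [hmonic.leadingCoeff, Ideal.mem_span_singleton]
    norm_num
  · intro n hn
    rw [hdeg] at hn
    have hn' : n < 4 := by exact_mod_cast hn
    rw [Ideal.mem_span_singleton]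
    interval_cases n <;> simp [coeff_X_pow, coeff_ofNat_mul]
  · rw [hdeg]; norm_num
  · rw [Ideal.span_singleton_pow, Ideal.mem_span_singleton]
    simp [coeff_X_pow, coeff_ofNat_mul]

/-- One root `t` modulo `p` yields four, `±t` and `±(t² - 2)/t`, distinct as `p` is odd. They give
four primes above `p`, which with `hK` forces equality. -/
theorem splitsIn_iff_exists_root {θ : 𝓞 K} (hθ : θ ^ 4 - 4 * θ ^ 2 + 2 = 0)
    (hK : Module.finrank ℚ K ≤ 4) {p : ℕ} [Fact p.Prime] (hp : p ≠ 2) :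
    SplitsIn p K ↔ ∃ t : ZMod p, t ^ 4 - 4 * t ^ 2 + 2 = 0 := by
  constructor
  · intro h
    obtain ⟨P, hP, hPx⟩ := h.exists_forall_sub_mem
    obtain ⟨n, hn⟩ := hPx θ
    have := hP.2
    refine ⟨n, ?_⟩
    have hmem : ((n ^ 4 - 4 * n ^ 2 + 2 : ℤ) : 𝓞 K) ∈ P := by
      have := P.mul_mem_left (-((θ + n) * (θ ^ 2 + n ^ 2 - 4))) hn
      convert this using 1
      push_cast
      linear_combination hθ
    simpa using (P.intCast_mem_iff_of_liesOver _).1 hmem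
  · rintro ⟨t, ht⟩
    have h2 : (2 : ZMod p) ≠ 0 := Ring.two_ne_zero (by rwa [ringChar.eq (ZMod p) p])
    have ht0 : t ≠ 0 := by
      rintro rfl
      apply h2
      linear_combination ht
    obtain ⟨s, hs⟩ : ∃ s, s * t = t ^ 2 - 2 := ⟨(t ^ 2 - 2) / t, div_mul_cancel₀ _ ht0⟩
    have hst : s ^ 2 + t ^ 2 = 4 := by
      apply mul_left_cancel₀ (pow_ne_zero 2 ht0)
      linear_combination (s * t + t ^ 2 - 2) * hs + 2 * ht
    have hs0 : s ≠ 0 := by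
      rintro rfl
      apply h2
      linear_combination -hst - hs
    have h1 : t ≠ s := by
      rintro rfl
      apply h2
      linear_combination hs
    have h3 : t ≠ -s := by
      rintro rfl
      apply h2
      linear_combination -hst - hs
    have hroots : ∀ x ∈ ({t, -t, s, -s} : Finset (ZMod p)), x ^ 4 - 4 * x ^ 2 + 2 = 0 := by
      have : s ^ 4 - 4 * s ^ 2 + 2 = 0 := by
        linear_combination ht + (s ^ 2 - t ^ 2) * hst
      intro x hx
      simp only [Finset.mem_insert, Finset.mem_singleton] at hx
      rcases hx with rfl | rfl | rfl | rfl <;> simpa [Even.neg_pow (by decide : Even 4)]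
    have hneg {x : ZMod p} (hx : x ≠ 0) : x ≠ -x := by
      intro h
      exact mul_ne_zero h2 hx (by linear_combination h)
    have hcard : ({t, -t, s, -s} : Finset (ZMod p)).card = 4 := by
      have h4 : -t ≠ s := fun h => h3 (by rw [← h, neg_neg])
      rw [Finset.card_insert_of_notMem, Finset.card_insert_of_notMem,
        Finset.card_pair (hneg hs0)] <;>
      simp [h1, h3, h4, hneg ht0]
    have key (x : ZMod p) (hx : x ∈ ({t, -t, s, -s} : Finset (ZMod p))) :
        ∃ P ∈ (Ideal.span {(p : ℤ)}).primesOver (𝓞 K), ∃ n : ℤ, (n : ZMod p) = x ∧ θ - n ∈ P := by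
      obtain ⟨n, rfl⟩ := ZMod.intCast_surjective x
      obtain ⟨P, hP, hPn⟩ := exists_mem_primesOver_sub_mem (p := p) irreducible_X_pow_four_sub
        (θ := θ) (by simpa only [map_add, map_sub, map_mul, map_pow, aeval_X, map_ofNat] using hθ) (a := n) (by simpa using hroots _ hx)
      exact ⟨P, hP, n, rfl, hPn⟩
    choose! P hP n hn hPn using key
    refine le_antisymm (ncard_primesOver_le_finrank p K) (hK.trans ?_)
    rw [Set.ncard_eq_toFinset_card _ (finite_primesOver_span_natCast p K), ← hcard]
    refine Finset.card_le_card_of_injOn P (fun x hx => by simpa using hP x hx) ?_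
    intro x hx y hy hxy
    have := (hP x hx).2
    -- A prime shared by two roots contains the difference of their integer lifts, so the roots
    -- agree modulo `p`.
    have hmem : ((n y - n x : ℤ) : 𝓞 K) ∈ P x := by
      have := (P x).sub_mem (hPn x hx) (hxy ▸ hPn y hy)
      simpa using this
    rw [(P x).intCast_mem_iff_of_liesOver (p := p), Int.cast_sub, hn x hx, hn y hy, sub_eq_zero] at hmem
    exact hmem.symm

theorem exists_quarticField_root :
    ∃ θ : 𝓞 quarticField, θ ^ 4 - 4 * θ ^ 2 + 2 = 0 := by
  have h2 : Real.sqrt 2 ^ 2 = 2 := Real.sq_sqrt (by norm_num)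
  have h : Real.sqrt (2 + Real.sqrt 2) ^ 2 = 2 + Real.sqrt 2 := Real.sq_sqrt (by positivity)
  let t : quarticField := ⟨_, IntermediateField.mem_adjoin_simple_self ℚ _⟩
  have ht : t ^ 4 - 4 * t ^ 2 + 2 = 0 := by
    apply Subtype.ext
    change Real.sqrt (2 + Real.sqrt 2) ^ 4 - 4 * Real.sqrt (2 + Real.sqrt 2) ^ 2 + 2 = 0
    linear_combination (Real.sqrt (2 + Real.sqrt 2) ^ 2 - 2 + Real.sqrt 2) * h + h2
  have hint : IsIntegral ℤ t :=
    ⟨X ^ 4 - 4 * X ^ 2 + 2, by monicity!, by simpa [eval₂_eq_eval_map] using ht⟩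
  exact ⟨⟨t, hint⟩, RingOfIntegers.ext ht⟩

theorem finrank_quarticField_le : Module.finrank ℚ quarticField ≤ 4 := by
  have h2 : Real.sqrt 2 ^ 2 = 2 := Real.sq_sqrt (by norm_num)
  have h : Real.sqrt (2 + Real.sqrt 2) ^ 2 = 2 + Real.sqrt 2 := Real.sq_sqrt (by positivity)
  have hroot : aeval (Real.sqrt (2 + Real.sqrt 2)) (X ^ 4 - 4 * X ^ 2 + 2 : ℚ[X]) = 0 := by
    simp only [map_add, map_sub, map_mul, map_pow, aeval_X, map_ofNat]
    linear_combination (Real.sqrt (2 + Real.sqrt 2) ^ 2 - 2 + Real.sqrt 2) * h + h2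
  have hmonic : (X ^ 4 - 4 * X ^ 2 + 2 : ℚ[X]).Monic := by monicity!
  have hdeg : (X ^ 4 - 4 * X ^ 2 + 2 : ℚ[X]).natDegree = 4 := by compute_degree!
  rw [quarticField, IntermediateField.adjoin.finrank ⟨_, hmonic, hroot⟩, ← hdeg]
  exact natDegree_le_of_dvd (minpoly.dvd ℚ _ hroot) hmonic.ne_zero

theorem splitsIn_quarticField_iff {p : ℕ} [Fact p.Prime] (hp : p ≠ 2) {r : ZMod p}
    (hr : r ^ 2 = 2) : SplitsIn p quarticField ↔ IsSquare (2 + r) := by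
  obtain ⟨θ, hθ⟩ := exists_quarticField_root
  rw [splitsIn_iff_exists_root hθ finrank_quarticField_le hp]
  constructor
  · rintro ⟨t, ht⟩
    have h2 : (2 : ZMod p) ≠ 0 := Ring.two_ne_zero (by rwa [ringChar.eq (ZMod p) p])
    have hprod : (t ^ 2 - 2 - r) * (t ^ 2 - 2 + r) = 0 := by
      linear_combination ht - hr
    rcases mul_eq_zero.1 hprod with h | h
    · exact ⟨t, by linear_combination -h⟩
    -- Here `2 - r` is the square; `(2 + r)(2 - r) = 2 = r²` transfers this to `2 + r`.
    · have hr' : (-r) ^ 2 = 2 := by rw [neg_sq, hr]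
      rw [isSquare_iff_isSquare_of_mul_eq_sq (two_add_ne_zero_of_sq_eq_two h2 hr)
        (two_add_ne_zero_of_sq_eq_two h2 hr') (w := r) (by linear_combination -2 * hr)]
      exact ⟨t, by linear_combination -h⟩
  · rintro ⟨t, ht⟩
    exact ⟨t, by linear_combination (-(t ^ 2) + 2 - r) * ht + hr⟩

end NumberField

/-! ### The Legendre symbol of `A + Br`. -/

theorem ZMod.mod_eight_of_legendreSym_two {p : ℕ} [Fact p.Prime] (hp : p ≠ 2)
    (h : legendreSym p 2 = 1) : p % 8 = 1 ∨ p % 8 = 7 := by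
  have h2 : ((2 : ℤ) : ZMod p) ≠ 0 := by
    exact_mod_cast Ring.two_ne_zero (by rwa [ringChar.eq (ZMod p) p])
  rw [legendreSym.eq_one_iff p h2] at h
  exact (ZMod.exists_sq_eq_two_iff hp).1 (by simpa using h)

theorem mainTheorem4 (A B C : ℤ) (hABC : A ^ 2 = 2 * (B ^ 2 + C ^ 2))
    (hAB : IsCoprime A B) (hBC : IsCoprime B C) (hCA : IsCoprime C A) (hA : 0 < A)
    (p : ℕ) [Fact p.Prime] (hp : p ≠ 2) (h2p : legendreSym p 2 = 1) :
    (∃ r : ℤ, (p : ℤ) ∣ r ^ 2 - 2 ∧ ¬ (p : ℤ) ∣ A + B * r) ∧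
    (∀ r : ℤ, (p : ℤ) ∣ r ^ 2 - 2 → ¬ (p : ℤ) ∣ A + B * r →
      (legendreSym p (A + B * r) = 1 ↔ SplitsIn p quarticField)) ∧
    (SplitsIn p quarticField ↔ ((p : ℤ) ≡ 1 [ZMOD 16] ∨ (p : ℤ) ≡ -1 [ZMOD 16])) := by
  have h2 : (2 : ZMod p) ≠ 0 := Ring.two_ne_zero (by rwa [ringChar.eq (ZMod p) p])
  have h2' : ((2 : ℤ) : ZMod p) ≠ 0 := by exact_mod_cast h2
  have hp8 := ZMod.mod_eight_of_legendreSym_two hp h2p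
  have hdvd (r : ℤ) : (p : ℤ) ∣ r ^ 2 - 2 ↔ (r : ZMod p) ^ 2 = 2 := by
    rw [← ZMod.intCast_zmod_eq_zero_iff_dvd]
    push_cast
    exact sub_eq_zero
  obtain ⟨r₀, hr₀⟩ : ∃ r : ℤ, (r : ZMod p) ^ 2 = 2 := by
    obtain ⟨s, hs⟩ := (legendreSym.eq_one_iff p h2').1 h2p
    obtain ⟨r, rfl⟩ := ZMod.intCast_surjective s
    exact ⟨r, by rw [pow_two, ← hs, Int.cast_ofNat]⟩
  refine ⟨?_, fun r hr hpr => ?_, ?_⟩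
  · by_cases h : (p : ℤ) ∣ A + B * r₀
    -- If `p` divided both `A ± B r₀`, it would divide the coprime `A` and `B`.
    · refine ⟨-r₀, (hdvd _).2 (by rw [Int.cast_neg, neg_sq, hr₀]), fun h' => ?_⟩
      rw [← ZMod.intCast_zmod_eq_zero_iff_dvd] at h h'
      push_cast at h h'
      have hA0 : (A : ZMod p) = 0 := by
        apply (mul_eq_zero.1 (?_ : 2 * (A : ZMod p) = 0)).resolve_left h2
        linear_combination h + h'
      have hB0 : (B : ZMod p) = 0 := by
        apply (mul_eq_zero.1 (?_ : 2 * (B : ZMod p) = 0)).resolve_left h2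
        linear_combination r₀ * h - r₀ * hA0 - B * hr₀
      obtain ⟨u, v, huv⟩ := hAB
      have := congrArg (Int.cast : ℤ → ZMod p) huv
      simp [hA0, hB0] at this
    · exact ⟨r₀, (hdvd _).2 hr₀, h⟩
  · rw [hdvd] at hr
    rw [← ZMod.intCast_zmod_eq_zero_iff_dvd] at hpr
    rw [legendreSym.eq_one_iff p hpr, splitsIn_quarticField_iff hp hr]
    obtain ⟨m, n, rfl, rfl⟩ := exists_param_of_sq_eq_two_mul hABC hBC hA
    refine isSquare_iff_isSquare_of_mul_eq_sq (w := (2 + r) * m + r * n) hpr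
      (two_add_ne_zero_of_sq_eq_two h2 hr) ?_
    push_cast
    linear_combination (-2 * n ^ 2 : ZMod p) * hr
  · rw [splitsIn_quarticField_iff hp hr₀, ZMod.isSquare_two_add_sqrt_two_iff hp hp8 hr₀,
      Int.modEq_iff_dvd, Int.modEq_iff_dvd]
    omega
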